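/- Let $H$ be a commutative semigroup with identity, written multiplicatively, with group of units $H^\times$, which is unit-cancellative (if $a,u\in H$ and $a=au$, then $u\in H^\times$) and atomic (every non-unit is a finite product of atoms, i.e. of non-units $p$ such that $p=ab$ implies $a\in H^\times$ or $b\in H^\times$). **Notation.** For a non-unit $a$ let $\mathsf L(a)$ be the set of all $k\in\mathbb N$ such that $a$ is a product of $k$ atoms; for a unit $a$ let $\mathsf L(a)=\{0\}$. Put $\mathscr L(H)=\{\mathsf L(a):a\in H\}$. For $L\subseteq\mathbb N_0$ let $\Delta(L)$ be the set of all $d\in\mathbb N$ such that for some $k\in L$ one has $L\cap[k,k+d]=\{k,k+d\}$; let $\rho(L)=\sup L^+/\min L^+$, where $L^+=L\cap\mathbb N$, if $L^+\neq\emptyset$, and $\rho(L)=1$ otherwise. Let $\Delta(H)=\bigcup_{L\in\mathscr L(H)}\Delta(L)$ and $\rho(H)=\sup_{L\in\mathscr L(H)}\rho(L)$. The monoid $H$ has accepted elasticity if $\rho(H)=\rho(L)<\infty$ for some $L\in\mathscr L(H)$. For $k\in\mathbb N$ let $\mathscr U_k(H)$ be the union of all $L\in\mathscr L(H)$ with $k\in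 L$ if $H\ne H^\times$, and $\mathscr U_k(H)=\{k\}$ if $H=H^\times$; let $\rho_k(H)=\sup\mathscr U_k(H)\in\mathbb N\cup\{\infty\}$. Let $H_{\rm red}=H/H^\times$ and let $\mathsf Z(H)$ be the free abelian monoid on the atoms of $H_{\rm red}$, with length function $|\cdot|$. For $a\in H$ let $\mathsf Z(a)$ be the set of all $z\in\mathsf Z(H)$ whose product in $H_{\rm red}$ is $aH^\times$. For $z,z'\in\mathsf Z(H)$ write $z=xy$, $z'=xy'$ with $x=\gcd(z,z')$, and let $\mathsf d(z,z')=\max\{|y|,|y'|\}$. Suprema of empty sets are $0$. Define the following elements of $\mathbb N_0\cup\{\infty\}$. - The catenary degree is $\mathsf c(H)=\sup_{a\in H}\mathsf c(a)$, where $\mathsf c(a)$ is the smallest $N$ such that for all $z,z'\in\mathsf Z(a)$ there are $z_0,\dots,z_k\in\mathsf Z(a)$ with $z_0=z$, $z_k=z'$ and $\mathsf d(z_{i-1},z_i)\le N$ for all $i\in\{1,\dots,k\}$. - The tame degree is $\mathsf t(H)=\sup_u\mathsf t(H,u)$ over all atoms $u$ of $H_{\rm red}$, where $\mathsf t(H,u)$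 is the smallest $N$ such that, for all $a\in H$ with $\mathsf Z(a)\cap u\mathsf Z(H)\ne\emptyset$ and all $z\in\mathsf Z(a)$, there is $z'\in\mathsf Z(a)\cap u\mathsf Z(H)$ with $\mathsf d(z,z')\le N$. - $\omega(H)=\sup_u\omega(H,u)$ over all atoms $u$ of $H$, where $\omega(H,u)$ is the smallest $N$ such that, whenever $n\in\mathbb N$, $a_1,\dots,a_n\in H$ and $u\mid a_1\cdots a_n$, there is $\Omega\subseteq\{1,\dots,n\}$ with $|\Omega|\le N$ and $u\mid\prod_{i\in\Omega}a_i$. An arithmetical progression with difference $d$ is a non-empty set $L\subseteq\mathbb N_0$ with $\Delta(L)\subseteq\{d\}$. The system $\mathscr L(H)$ satisfies the Structure Theorem for Unions if there are $d\in\mathbb N$ and $M\in\mathbb N_0$ such that, for all sufficiently large $k$, the set $U=\mathscr U_k(H)$ is contained in $y+d\mathbb Z$ for some $y\in\mathbb Z$, and $U\cap[\inf U+M,\ \sup U-M]$ is an arithmetical progression with difference $d$. **Theorem.** 1. Suppose that $\mathsf c(H)<\infty$ and that $H$ has accepted elasticity. Then $\Delta(H)$ is finite, and there is $K\in\mathbb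 N_0$ such that $\rho_{k+1}(H)\le\rho_k(H)+K$ for all $k\in\mathbb N$. 2. Suppose that $H$ is cancellative and $\omega(H)<\infty$. Then $\mathsf c(H)\le\mathsf t(H)\le\omega(H)^2$; $\rho(H)\le\omega(H)$ provided that $H\neq H^\times$; and $\rho_{k+1}(H)\le\rho_k(H)+\max\{1,\omega(H)-1\}$ for all $k\in\mathbb N$. In both cases, $\mathscr L(H)$ satisfies the Structure Theorem for Unions. -/

import Mathlib

open scoped ENNReal

noncomputable section

namespace LengthSets

/-! ### Subsets and families of subsets of the non-negative integers -/

/-- The set of distances of `L ⊆ ℕ`: all `d ≥ 1` such that `k, k + d ∈ L` for some `k`, with no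
element of `L` strictly in between. -/
def distances (L : Set ℕ) : Set ℕ :=
  {d | 0 < d ∧ ∃ k ∈ L, k + d ∈ L ∧ ∀ m ∈ L, ¬ (k < m ∧ m < k + d)}

/-- `L` is an arithmetical progression with difference `d`: it is non-empty and has no distance
other than `d`. (A one-point set is one for every `d`.) -/
def IsAP (d : ℕ) (L : Set ℕ) : Prop :=
  L.Nonempty ∧ distances L ⊆ {d}

/-- The supremum of `L ⊆ ℕ` in `ℕ ∪ {∞}`. -/
def supSet (L : Set ℕ) : ℕ∞ := ⨆ n ∈ L, (n : ℕ∞)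

/-- `L` is an almost arithmetical progression with difference `d` and bound `M`:
`L ⊆ y + dℤ` for some integer `y`, and `L ∩ [inf L + M, sup L - M]` is an arithmetical progression
with difference `d` (in particular, it is non-empty). The condition `x ≤ sup L - M` is written
`x + M ≤ sup L`, so it is void when `L` is infinite. -/
def IsAAP (d M : ℕ) (L : Set ℕ) : Prop :=
  (∃ y : ℤ, ∀ x ∈ L, (d : ℤ) ∣ (x : ℤ) - y) ∧
    IsAP d {x ∈ L | sInf L + M ≤ x ∧ (x : ℕ∞) + (M : ℕ∞) ≤ supSet L}

/-- The elasticity of `L ⊆ ℕ`: the supremum of the positive elements of `L` divided by their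
minimum, and `1` if `L` has no positive element. -/
def elasticity (L : Set ℕ) : ℝ≥0∞ :=
  open Classical in
  if ∃ n ∈ L, 0 < n then
    ((supSet {n ∈ L | 0 < n} : ℕ∞) : ℝ≥0∞) / ((sInf {n ∈ L | 0 < n} : ℕ) : ℝ≥0∞)
  else 1

/-- `𝓤_k(𝓛)`, the union of all members of the family `𝓛` that contain `k`. -/
def unionAt (𝓛 : Set (Set ℕ)) (k : ℕ) : Set ℕ :=
  {n | ∃ L ∈ 𝓛, k ∈ L ∧ n ∈ L}

/-- The Structure Theorem for Unions, for a sequence `U_0, U_1, …` of unions: there are `d ≥ 1` and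
`M ≥ 0` such that `U_k` is an almost arithmetical progression with difference `d` and bound `M`
for all sufficiently large `k`. -/
def StructureTheoremForUnions (U : ℕ → Set ℕ) : Prop :=
  ∃ d M : ℕ, 0 < d ∧ ∀ᶠ k in Filter.atTop, IsAAP d M (U k)

/-! ### Monoids and their lengths -/

section Monoids

variable (H : Type*) [CommMonoid H]

/-- `H` is unit-cancellative: `a = a u` implies that `u` is a unit. -/
def IsUnitCancellative : Prop := ∀ a u : H, a = a * u → IsUnit u

/-- `H` is atomic: every non-unit is a finite product of atoms. -/
def IsAtomicMonoid : Prop :=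
  ∀ a : H, ¬ IsUnit a → ∃ s : Multiset H, (∀ u ∈ s, Irreducible u) ∧ s.prod = a

variable {H} in
/-- The set of lengths of `a`: all `k` such that `a` is a product of `k` atoms, and `{0}` if `a` is
a unit. -/
def lengths (a : H) : Set ℕ :=
  open Classical in
  if IsUnit a then {0}
  else {k | ∃ s : Multiset H, (∀ u ∈ s, Irreducible u) ∧ s.prod = a ∧ s.card = k}

/-- The system of sets of lengths of `H`. -/
def systemOfLengths : Set (Set ℕ) := Set.range (lengths : H → Set ℕ)

/-- The set of distances `Δ(H)`. -/
def distancesOf : Set ℕ := ⋃ L ∈ systemOfLengths H, distances L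

/-- The elasticity `ρ(H)`. (If all elements of `H` are units, it is `1`.) -/
def elasticityOf : ℝ≥0∞ := ⨆ L ∈ systemOfLengths H, elasticity L

/-- `H` has accepted elasticity: `ρ(H) = ρ(L) < ∞` for some set of lengths `L`. -/
def HasAcceptedElasticity : Prop :=
  ∃ L ∈ systemOfLengths H, elasticityOf H = elasticity L ∧ elasticity L < ⊤

/-- `𝓤_k(H)`, the union of all sets of lengths that contain `k`; by convention it is `{k}` if all
elements of `H` are units. -/
def unionsOfLengths (k : ℕ) : Set ℕ :=
  open Classical in
  if ∀ a : H, IsUnit a then {k} else unionAt (systemOfLengths H) k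

/-- `ρ_k(H) = sup 𝓤_k(H)`. -/
def rhoAt (k : ℕ) : ℕ∞ := supSet (unionsOfLengths H k)

/-! ### Factorizations, catenary degree, tame degree, `ω`-invariant -/

/-- The atoms of the associated reduced monoid `H_red`. -/
abbrev RedAtom := {u : Associates H // Irreducible u}

/-- The factorization monoid `Z(H)`: the free abelian monoid on the atoms of `H_red`, realised as
finite multisets, so its operation is written additively, the length of `z` is its cardinality, and
`z ∈ u Z(H)` means `u ∈ z`. -/
abbrev Factorization := Multiset (RedAtom H)

variable {H}

/-- The canonical homomorphism `Z(H) → H_red`. -/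
def evalFactorization (z : Factorization H) : Associates H := (z.map Subtype.val).prod

/-- The set `Z(a)` of factorizations of `a`. -/
def factorizations (a : H) : Set (Factorization H) :=
  {z | evalFactorization z = Associates.mk a}

/-- The distance `d(z, z')`: the larger of the numbers of atoms that remain in `z` and in `z'` when
their greatest common part has been removed. -/
def factDist (z z' : Factorization H) : ℕ :=
  open Classical in max (z - z').card (z' - z).card

/-- The catenary degree `c(a)`: the smallest `N ∈ ℕ ∪ {∞}` such that any two factorizations of `a`
are joined by a finite chain of factorizations of `a` with successive distances at most `N`. -/
def catenaryAt (a : H) : ℕ∞ :=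
  sInf {N : ℕ∞ | ∀ z ∈ factorizations a, ∀ z' ∈ factorizations a,
    ∃ (k : ℕ) (w : ℕ → Factorization H), w 0 = z ∧ w k = z' ∧
      (∀ i ≤ k, w i ∈ factorizations a) ∧
      ∀ i < k, (factDist (w i) (w (i + 1)) : ℕ∞) ≤ N}

/-- The invariant `ω(H, I)`: the smallest `N ∈ ℕ ∪ {∞}` such that every finite product lying in `I`
has a subproduct of at most `N` factors lying in `I`. -/
def omegaSet (I : Set H) : ℕ∞ :=
  sInf {N : ℕ∞ | ∀ n : ℕ, 0 < n → ∀ a : Fin n → H, ∏ i, a i ∈ I →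
    ∃ Ω : Finset (Fin n), (Ω.card : ℕ∞) ≤ N ∧ ∏ i ∈ Ω, a i ∈ I}

/-- `ω(H, a) = ω(H, aH)`. -/
def omegaAt (a : H) : ℕ∞ := omegaSet {b : H | a ∣ b}

/-- `t(H, u)`: the smallest `N ∈ ℕ ∪ {∞}` such that, whenever some factorization of `a` contains
the atom `u`, every factorization of `a` has distance at most `N` to one that contains `u`. -/
def tameAt (u : RedAtom H) : ℕ∞ :=
  sInf {N : ℕ∞ | ∀ a : H, (∃ y ∈ factorizations a, u ∈ y) → ∀ z ∈ factorizations a,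
    ∃ z' ∈ factorizations a, u ∈ z' ∧ (factDist z z' : ℕ∞) ≤ N}

variable (H)

/-- The catenary degree `c(H)`. -/
def catenaryDegree : ℕ∞ := ⨆ a : H, catenaryAt a

/-- `ω(H)`, the supremum of `ω(H, u)` over all atoms `u` of `H`. -/
def omega : ℕ∞ := ⨆ (u : H) (_ : Irreducible u), omegaAt u

/-- The tame degree `t(H)`. -/
def tameDegree : ℕ∞ := ⨆ u : RedAtom H, tameAt u

end Monoids

end LengthSets

end

namespace LengthSets

/-! The Structure Theorem is a statement about sequences `U` that are symmetric and additive. It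
needs two inputs: gaps above `k` in `U k` are bounded, and passing from `U (k + 1)` to `U k` costs
at most a constant (`IsUnionSystem.structureTheorem`). The first follows from a finite catenary
degree, as lengths along a chain change by at most `c(H)` per step (`lengths_gap`).

The second has two sources. If the elasticity `n / m` is attained, multiples of the pair `(m, n)`
come within a constant of the bound `k * n / m`. If `H` is cancellative with finite `ω`, an atom `u`
dividing a factorization `z` divides the product of at most `ω` atoms of `z`; rewriting these as `u
* y` and cancelling `u` is the exchange behind every estimate in the second half. -/

/-! ### Suprema and abstract systems of unions. -/

theorem exists_ge_of_le_supSet {L : Set ℕ} (hL : L.Nonempty) {t : ℕ} (h : (t : ℕ∞) ≤ supSet L) :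
    ∃ n ∈ L, t ≤ n := by
  by_contra! hc
  obtain ⟨n₀, hn₀⟩ := hL
  have ht : 0 < t := (Nat.zero_le _).trans_lt (hc n₀ hn₀)
  have h1 : supSet L ≤ ((t - 1 : ℕ) : ℕ∞) :=
    iSup₂_le fun n hn => by exact_mod_cast Nat.le_sub_one_of_lt (hc n hn)
  have h2 : t ≤ t - 1 := by exact_mod_cast h.trans h1
  omega

theorem le_supSet {L : Set ℕ} {n : ℕ} (hn : n ∈ L) : (n : ℕ∞) ≤ supSet L :=
  le_iSup₂ (f := fun (n : ℕ) (_ : n ∈ L) => (n : ℕ∞)) n hn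

/-- A finite supremum is attained. -/
theorem exists_mem_supSet_eq {L : Set ℕ} (hL : L.Nonempty) (h : supSet L ≠ ⊤) :
    ∃ n ∈ L, supSet L = n := by
  obtain ⟨t, ht⟩ := ENat.ne_top_iff_exists.1 h
  obtain ⟨n, hn, htn⟩ := exists_ge_of_le_supSet hL ht.le
  exact ⟨n, hn, le_antisymm (ht ▸ by exact_mod_cast htn) (le_supSet hn)⟩

/-- The formal properties of the unions `𝓤_k` of a directed family of subsets of `ℕ`. -/
structure IsUnionSystem (U : ℕ → Set ℕ) : Prop where
  symm : ∀ {k n}, n ∈ U k → k ∈ U n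
  add : ∀ {k l m n}, m ∈ U k → n ∈ U l → m + n ∈ U (k + l)
  zero : 0 ∈ U 0
  one : 1 ∈ U 1

namespace IsUnionSystem

variable {U : ℕ → Set ℕ}

theorem mul (hU : IsUnionSystem U) {m n : ℕ} (h : n ∈ U m) (q : ℕ) : q * n ∈ U (q * m) := by
  induction q with
  | zero => simpa using hU.zero
  | succ q ih => simpa [add_mul] using hU.add ih h

theorem self_mem (hU : IsUnionSystem U) (k : ℕ) : k ∈ U k := by
  simpa using hU.mul hU.one k

/-- All differences of elements in a common union are the multiples of one integer. -/
theorem exists_modulus (hU : IsUnionSystem U) :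
    ∃ d : ℕ, (∀ k, ∀ n ∈ U k, (d : ℤ) ∣ (n : ℤ) - k) ∧ ∃ a, a + d ∈ U a := by
  -- Additivity of `U` closes the differences under sums and symmetry closes them under negation, so
  -- the generator is itself a difference.
  let D : AddSubgroup ℤ :=
    { carrier := {e | ∃ k n : ℕ, n ∈ U k ∧ e = (n : ℤ) - k}
      zero_mem' := ⟨0, 0, hU.zero, by simp⟩
      add_mem' := by
        rintro _ _ ⟨k, n, h, rfl⟩ ⟨k', n', h', rfl⟩
        exact ⟨k + k', n + n', hU.add h h', by push_cast; ring⟩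
      neg_mem' := by
        rintro _ ⟨k, n, h, rfl⟩
        exact ⟨n, k, hU.symm h, by ring⟩ }
  obtain ⟨g, hg⟩ := Int.subgroup_cyclic D
  have hmem : ∀ e, e ∈ D ↔ g ∣ e := fun e => by
    rw [hg, AddSubgroup.mem_closure_singleton]
    constructor
    · rintro ⟨n, rfl⟩
      exact ⟨n, by simp [mul_comm]⟩
    · rintro ⟨n, rfl⟩
      exact ⟨n, by simp [mul_comm]⟩
  refine ⟨g.natAbs, fun k n hn => Int.natAbs_dvd.2 ((hmem _).1 ⟨k, n, hn, rfl⟩), ?_⟩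
  obtain ⟨k, n, hn, h⟩ : ((g.natAbs : ℕ) : ℤ) ∈ D := (hmem _).2 Int.dvd_natAbs_self
  refine ⟨k, ?_⟩
  have : k + g.natAbs = n := by omega
  rwa [this]

/-- The bound is stated for elements rather than suprema, so it keeps its content when the unions
are infinite. -/
theorem exists_of_mem_add {K : ℕ} (hK : ∀ k, 1 ≤ k → ∀ n ∈ U (k + 1), ∃ m ∈ U k, n ≤ m + K)
    {k : ℕ} (hk : 1 ≤ k) (p : ℕ) : ∀ n ∈ U (k + p), ∃ m ∈ U k, n ≤ m + p * K := by
  induction p with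
  | zero => exact fun n hn => ⟨n, hn, by simp⟩
  | succ p ih =>
    intro n hn
    obtain ⟨m, hm, hnm⟩ := hK (k + p) (by omega) n hn
    obtain ⟨m', hm', hmm'⟩ := ih m hm
    exact ⟨m', hm', by rw [add_mul]; omega⟩

/-- The Structure Theorem for Unions holds as soon as the gaps in sets of lengths are bounded and
the suprema of the unions grow in bounded steps. -/
theorem structureTheorem (hU : IsUnionSystem U) {δ K : ℕ}
    (hgap : ∀ k, ∀ n ∈ U k, ∀ t, k ≤ t → t ≤ n → ∃ l ∈ U k, l ≤ t ∧ t ≤ l + δ)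
    (hK : ∀ k, 1 ≤ k → ∀ n ∈ U (k + 1), ∃ m ∈ U k, n ≤ m + K) :
    StructureTheoremForUnions U := by
  obtain ⟨d, hd, a, ha⟩ := hU.exists_modulus
  rcases Nat.eq_zero_or_pos d with rfl | hd0
  · have hsub : ∀ k, U k = {k} := fun k => by
      ext n
      refine ⟨fun hn => ?_, fun hn => by rw [Set.mem_singleton_iff.1 hn]; exact hU.self_mem k⟩
      have := hd k n hn
      simp only [Nat.cast_zero, zero_dvd_iff] at this
      simp only [Set.mem_singleton_iff]
      omega
    refine ⟨1, 0, one_pos, Filter.Eventually.of_forall fun k => ?_⟩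
    rw [hsub]
    refine ⟨⟨0, by simp⟩, ⟨k, by simp, by simp, by simpa using le_supSet (Set.mem_singleton k)⟩, ?_⟩
    rintro e ⟨he, x, ⟨hx, -⟩, ⟨hy, -⟩, -⟩
    simp only [Set.mem_singleton_iff] at hx hy
    omega
  -- `U p` contains `p + d * j` for every `j ≤ δ`: use `a + d ∈ U a` for `j` of the `δ` blocks of
  -- size `a`. This fills any gap of length at most `δ`.
  set p := δ * a with hp
  -- Set `p` aside: `U (k - p)` still reaches up to `t` and has an element `l` at most `δ` below `t
  -- - p`. The reserved `p` then supplies the missing multiple of `d`.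
  have upper : ∀ k t n, p < k → k ≤ t → (d : ℤ) ∣ (t : ℤ) - k → n ∈ U k → t + p * K ≤ n →
      t ∈ U k := by
    intro k t n hpk hkt hdt hn htn
    obtain ⟨k', rfl⟩ := Nat.exists_eq_add_of_le' hpk.le
    obtain ⟨m, hm, hnm⟩ := exists_of_mem_add hK (by omega) p n hn
    obtain ⟨l, hl, hlt, htl⟩ := hgap k' m hm (t - p) (by omega) (by omega)
    have hdl : (d : ℤ) ∣ ((t - p - l : ℕ) : ℤ) := by
      have := dvd_sub hdt (hd k' l hl)
      rwa [show ((t : ℤ) - (k' + p : ℕ)) - (l - k') = ((t - p - l : ℕ) : ℤ) by omega] at this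
    obtain ⟨j, hj⟩ := Int.natCast_dvd_natCast.1 hdl
    have hjδ : j ≤ δ := by
      have : j ≤ d * j := Nat.le_mul_of_pos_left j hd0
      omega
    obtain ⟨i, rfl⟩ := Nat.exists_eq_add_of_le hjδ
    have h := hU.add hl (hU.add (hU.mul ha j) (hU.self_mem (i * a)))
    have e1 : k' + (j * a + i * a) = k' + p := by rw [hp]; ring
    have e2 : l + (j * (a + d) + i * a) = t := by
      have : j * (a + d) + i * a = p + d * j := by rw [hp]; ring
      omega
    rwa [e1, e2] at h
  -- `p * K` is the loss in `upper`; `p + 1` ensures `p < t` when `upper` is applied with base `t`.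
  set M := p * K + p + 1 with hM
  refine ⟨d, M, hd0, Filter.eventually_atTop.2 ⟨M * (a + d), fun k hk => ?_⟩⟩
  have full : ∀ t : ℕ, (d : ℤ) ∣ (t : ℤ) - k → sInf (U k) + M ≤ t →
      (t : ℕ∞) + (M : ℕ∞) ≤ supSet (U k) → p < k → t ∈ U k := by
    intro t hdt hlow hup hpk
    rcases le_total k t with hkt | htk
    · obtain ⟨n, hn, htn⟩ := exists_ge_of_le_supSet (L := U k) (t := t + M)
        ⟨k, hU.self_mem k⟩ (by exact_mod_cast hup)
      exact upper k t n hpk hkt hdt hn (by omega)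
    -- Below `k` the roles are exchanged: `k ∈ U t` is proved instead, since `U t` contains `k + (t
    -- - sInf (U k))`, which exceeds `k` by at least `M`.
    · have hmin : sInf (U k) ∈ U k := Nat.sInf_mem ⟨k, hU.self_mem k⟩
      have h := hU.add (hU.symm hmin) (hU.self_mem (t - sInf (U k)))
      rw [show sInf (U k) + (t - sInf (U k)) = t by omega] at h
      exact hU.symm (upper t k _ (by omega) htk (by rw [← dvd_neg, neg_sub]; exact hdt) h
        (by omega))
  have hMd : M ≤ M * d := Nat.le_mul_of_pos_right M hd0
  have hMad : M * (a + d) = M * a + M * d := by ring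
  have hpk : p < k := by omega
  -- The point `k` lies in the central part: `M` copies of `a + d ∈ U a` and its mirror image put `k
  -- + M * d` and `k - M * d` into `U k`.
  refine ⟨⟨k, hd k⟩, ⟨k, hU.self_mem k, ?_, ?_⟩, ?_⟩
  · have h := hU.add (hU.symm (hU.mul ha M)) (hU.self_mem (k - M * (a + d)))
    rw [show M * (a + d) + (k - M * (a + d)) = k by omega] at h
    have := Nat.sInf_le h
    omega
  · have h := hU.add (hU.mul ha M) (hU.self_mem (k - M * a))
    rw [show M * a + (k - M * a) = k by omega] at h
    refine le_trans ?_ (le_supSet h)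
    exact_mod_cast (by omega)
  · rintro e ⟨he, x, ⟨hx, hx1, hx2⟩, ⟨hy, hy1, hy2⟩, hno⟩
    have hde : (d : ℤ) ∣ (e : ℤ) := by
      have := dvd_sub (hd k _ hy) (hd k _ hx)
      rwa [show (((x + e : ℕ) : ℤ) - k) - (x - k) = (e : ℤ) by push_cast; ring] at this
    have hle : d ≤ e := Nat.le_of_dvd he (Int.natCast_dvd_natCast.1 hde)
    rcases hle.eq_or_lt with h | hlt
    · exact h.symm
    · have hup : ((x + d : ℕ) : ℕ∞) + (M : ℕ∞) ≤ supSet (U k) :=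
        le_trans (by exact_mod_cast (by omega)) hy2
      refine (hno (x + d) ⟨full _ ?_ (by omega) hup hpk, by omega, hup⟩
        ⟨by omega, by omega⟩).elim
      have := dvd_add (hd k _ hx) (dvd_refl (d : ℤ))
      rwa [show (x : ℤ) - k + d = ((x + d : ℕ) : ℤ) - k by push_cast; ring] at this

end IsUnionSystem

/-! ### Factorizations in the reduced monoid, lengths and unions. -/

section Factorizations

variable {H : Type*} [CommMonoid H]

theorem irreducible_associatesMk {a : H} : Irreducible (Associates.mk a) ↔ Irreducible a := by
  simp only [irreducible_iff, Associates.isUnit_mk, Associates.forall_associated,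
    Associates.mk_mul_mk, Associates.mk_eq_mk_iff_associated, Associated.comm (x := a)]
  refine Iff.rfl.and ⟨fun h x y hxy => h x y (hxy ▸ Associated.refl _), ?_⟩
  rintro h x y ⟨w, hw⟩
  have := @h x (y * w) (by rw [← hw, mul_assoc])
  rwa [Units.isUnit_mul_units] at this

@[simp] theorem evalFactorization_zero : evalFactorization (0 : Factorization H) = 1 := by
  simp [evalFactorization]

@[simp] theorem evalFactorization_cons (u : RedAtom H) (z : Factorization H) :
    evalFactorization (u ::ₘ z) = u.1 * evalFactorization z := by
  simp [evalFactorization]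

@[simp] theorem evalFactorization_add (z z' : Factorization H) :
    evalFactorization (z + z') = evalFactorization z * evalFactorization z' := by
  simp [evalFactorization]

theorem eq_zero_of_isUnit_evalFactorization {z : Factorization H}
    (h : IsUnit (evalFactorization z)) : z = 0 := by
  induction z using Multiset.induction with
  | empty => rfl
  | cons u z _ =>
    rw [evalFactorization_cons] at h
    exact (u.2.not_isUnit (isUnit_of_mul_isUnit_left h)).elim

theorem card_eq_one_of_evalFactorization_eq {z : Factorization H} {u : RedAtom H}
    (h : evalFactorization z = u.1) : z.card = 1 := by
  have hu := u.2
  rw [← h] at hu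
  induction z using Multiset.induction with
  | empty => simp at hu
  | cons v z _ =>
    rw [evalFactorization_cons] at hu
    rcases hu.isUnit_or_isUnit rfl with h | h
    · exact (v.2.not_isUnit h).elim
    · simp [eq_zero_of_isUnit_evalFactorization h]

theorem exists_factorization_of_multiset (s : Multiset H) (hs : ∀ u ∈ s, Irreducible u) :
    ∃ z : Factorization H, evalFactorization z = Associates.mk s.prod ∧ z.card = s.card := by
  induction s using Multiset.induction with
  | empty => exact ⟨0, by simp, by simp⟩
  | cons u s ih =>
    obtain ⟨z, hz, hc⟩ := ih fun v hv => hs v (Multiset.mem_cons_of_mem hv)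
    exact ⟨⟨_, irreducible_associatesMk.2 (hs u (Multiset.mem_cons_self u s))⟩ ::ₘ z,
      by simp [hz, ← Associates.mk_mul_mk], by simp [hc]⟩

theorem exists_multiset_of_factorization (z : Factorization H) {a : H} (ha : ¬ IsUnit a)
    (hz : evalFactorization z = Associates.mk a) :
    ∃ s : Multiset H, (∀ u ∈ s, Irreducible u) ∧ s.prod = a ∧ s.card = z.card := by
  have key : ∀ z : Factorization H, ∃ s : Multiset H, (∀ u ∈ s, Irreducible u) ∧
      Associates.mk s.prod = evalFactorization z ∧ s.card = z.card := by
    intro z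
    induction z using Multiset.induction with
    | empty => exact ⟨0, by simp, by simp, rfl⟩
    | cons u z ih =>
      obtain ⟨s, hs, hp, hc⟩ := ih
      obtain ⟨v, hv⟩ := Associates.mk_surjective u.1
      refine ⟨v ::ₘ s, ?_, ?_, by simp [hc]⟩
      · intro w hw
        rcases Multiset.mem_cons.1 hw with rfl | hw
        · exact irreducible_associatesMk.1 (hv ▸ u.2)
        · exact hs w hw
      · rw [Multiset.prod_cons, ← Associates.mk_mul_mk, hv, hp, evalFactorization_cons]
  induction z using Multiset.induction with
  | empty =>
    refine (ha ?_).elim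
    rw [← Associates.isUnit_mk, ← hz]
    simp
  | cons u z _ =>
    obtain ⟨s, hs, hp, hc⟩ := key z
    obtain ⟨v, hv⟩ := Associates.mk_surjective u.1
    rw [evalFactorization_cons, ← hp, ← hv, Associates.mk_mul_mk,
      Associates.mk_eq_mk_iff_associated] at hz
    obtain ⟨w, hw⟩ := hz
    have hvi : Irreducible (v * w) := by
      rw [← irreducible_associatesMk, ← Associates.mk_mul_mk,
        (Associates.mk_eq_one (a := (w : H))).2 w.isUnit, mul_one, hv]
      exact u.2
    -- A factorization determines the product only up to a unit, which is absorbed into one atom; a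
    -- non-unit has at least one.
    refine ⟨(v * w) ::ₘ s, ?_, by rw [Multiset.prod_cons, ← hw]; ac_rfl, by simp [hc]⟩
    intro x hx
    rcases Multiset.mem_cons.1 hx with rfl | hx
    · exact hvi
    · exact hs x hx

/-- The convention `{0}` for units is consistent with factorizations: the empty one is the only
factorization of a unit. -/
theorem mem_lengths_iff {a : H} {n : ℕ} :
    n ∈ lengths a ↔ ∃ z ∈ factorizations a, z.card = n := by
  unfold lengths
  split_ifs with ha
  · rw [Set.mem_singleton_iff]
    constructor
    · rintro rfl
      exact ⟨0, by simp [factorizations, Associates.mk_eq_one.2 ha], rfl⟩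
    · rintro ⟨z, hz, rfl⟩
      rw [eq_zero_of_isUnit_evalFactorization (z := z)
        (by rw [show evalFactorization z = _ from hz]; exact Associates.isUnit_mk.2 ha)]
      rfl
  · constructor
    · rintro ⟨s, hs, rfl, rfl⟩
      exact exists_factorization_of_multiset s hs
    · rintro ⟨z, hz, rfl⟩
      exact exists_multiset_of_factorization z ha hz

theorem exists_factorization (hat : IsAtomicMonoid H) (a : Associates H) :
    ∃ z : Factorization H, evalFactorization z = a := by
  obtain ⟨a, rfl⟩ := Associates.mk_surjective a
  by_cases ha : IsUnit a
  · exact ⟨0, by simp [Associates.mk_eq_one.2 ha]⟩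
  · obtain ⟨s, hs, rfl⟩ := hat a ha
    obtain ⟨z, hz, -⟩ := exists_factorization_of_multiset s hs
    exact ⟨z, hz⟩

theorem exists_redAtom (hat : IsAtomicMonoid H) (hne : ∃ a : H, ¬ IsUnit a) :
    Nonempty (RedAtom H) := by
  obtain ⟨a, ha⟩ := hne
  obtain ⟨z, hz⟩ := exists_factorization hat (Associates.mk a)
  induction z using Multiset.induction with
  | empty => exact (ha (Associates.isUnit_mk.1 (hz ▸ by simp))).elim
  | cons u z _ => exact ⟨u⟩

theorem unionsOfLengths_of_forall_isUnit (h : ∀ a : H, IsUnit a) (k : ℕ) :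
    unionsOfLengths H k = {k} := if_pos h

theorem unionsOfLengths_of_exists (h : ∃ a : H, ¬ IsUnit a) (k : ℕ) :
    unionsOfLengths H k = unionAt (systemOfLengths H) k :=
  if_neg (not_forall.2 h)

theorem mem_unionsOfLengths_iff (h : ∃ a : H, ¬ IsUnit a) {k n : ℕ} :
    n ∈ unionsOfLengths H k ↔ ∃ z z' : Factorization H,
      evalFactorization z = evalFactorization z' ∧ z.card = k ∧ z'.card = n := by
  rw [unionsOfLengths_of_exists h]
  constructor
  · rintro ⟨_, ⟨a, rfl⟩, hk, hn⟩
    obtain ⟨z, hz, rfl⟩ := mem_lengths_iff.1 hk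
    obtain ⟨z', hz', rfl⟩ := mem_lengths_iff.1 hn
    exact ⟨z, z', Eq.trans hz (Eq.symm hz'), rfl, rfl⟩
  · rintro ⟨z, z', hzz', rfl, rfl⟩
    obtain ⟨a, ha⟩ := Associates.mk_surjective (evalFactorization z)
    exact ⟨_, ⟨a, rfl⟩, mem_lengths_iff.2 ⟨z, ha.symm, rfl⟩,
      mem_lengths_iff.2 ⟨z', hzz'.symm.trans ha.symm, rfl⟩⟩

theorem isUnionSystem_unionsOfLengths (hat : IsAtomicMonoid H) :
    IsUnionSystem (unionsOfLengths H) := by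
  by_cases h : ∀ a : H, IsUnit a
  · rw [funext (unionsOfLengths_of_forall_isUnit h)]
    constructor <;> simp +contextual
  rw [not_forall] at h
  refine ⟨fun hn => ?_, fun hm hn => ?_, ?_, ?_⟩
  · rw [mem_unionsOfLengths_iff h] at hn ⊢
    obtain ⟨z, z', hz, hk, hn⟩ := hn
    exact ⟨z', z, hz.symm, hn, hk⟩
  · rw [mem_unionsOfLengths_iff h] at hm hn ⊢
    obtain ⟨z, z', hz, hk, hm⟩ := hm
    obtain ⟨y, y', hy, hl, hn⟩ := hn
    exact ⟨z + y, z' + y', by simp [hz, hy], by simp [hk, hl], by simp [hm, hn]⟩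
  · exact (mem_unionsOfLengths_iff h).2 ⟨0, 0, rfl, rfl, rfl⟩
  · obtain ⟨u⟩ := exists_redAtom hat h
    exact (mem_unionsOfLengths_iff h).2 ⟨{u}, {u}, rfl, by simp, by simp⟩

/-! ### Distances between factorizations and the catenary degree -/

theorem card_le_card_add_factDist (z z' : Factorization H) :
    z'.card ≤ z.card + factDist z z' := by
  classical
  have h : z' ≤ z + (z' - z) := le_add_tsub
  have := Multiset.card_le_card h
  rw [Multiset.card_add] at this
  unfold factDist
  exact this.trans (Nat.add_le_add_left (by convert le_max_right _ _) _)

theorem factDist_add_right (x y z : Factorization H) :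
    factDist (y + x) (z + x) = factDist y z := by
  classical
  unfold factDist
  simp only [add_tsub_add_eq_tsub_right]

theorem factDist_cons (u : RedAtom H) (y z : Factorization H) :
    factDist (u ::ₘ y) (u ::ₘ z) = factDist y z := by
  rw [← factDist_add_right {u} y z, ← Multiset.singleton_add, ← Multiset.singleton_add,
    add_comm y, add_comm z]

theorem factDist_le_max (y z : Factorization H) : factDist y z ≤ max y.card z.card := by
  classical
  unfold factDist
  exact max_le_max (Multiset.card_le_card tsub_le_self) (Multiset.card_le_card tsub_le_self)

/-- The infimum is attained because `ℕ∞` is well-ordered and `⊤` is always admissible. -/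
theorem catenaryAt_spec (a : H) : ∀ z ∈ factorizations a, ∀ z' ∈ factorizations a,
    ∃ (k : ℕ) (w : ℕ → Factorization H), w 0 = z ∧ w k = z' ∧
      (∀ i ≤ k, w i ∈ factorizations a) ∧
      ∀ i < k, (factDist (w i) (w (i + 1)) : ℕ∞) ≤ catenaryAt a := by
  refine csInf_mem (s := {N : ℕ∞ | ∀ z ∈ factorizations a, ∀ z' ∈ factorizations a,
    ∃ (k : ℕ) (w : ℕ → Factorization H), w 0 = z ∧ w k = z' ∧
      (∀ i ≤ k, w i ∈ factorizations a) ∧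
      ∀ i < k, (factDist (w i) (w (i + 1)) : ℕ∞) ≤ N}) ⟨⊤, fun z hz z' hz' => ?_⟩
  refine ⟨1, fun i => if i = 0 then z else z', by simp, by simp, fun i _ => ?_, fun _ _ => le_top⟩
  dsimp only
  split_ifs
  exacts [hz, hz']

/-- A sequence of integers with steps at most `c` has no larger gaps. -/
theorem exists_le_le_add_of_steps (f : ℕ → ℕ) {c t m : ℕ} (h0 : f 0 ≤ t) (hm : t ≤ f m)
    (hf : ∀ i < m, f (i + 1) ≤ f i + c) : ∃ i ≤ m, f i ≤ t ∧ t ≤ f i + c := by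
  induction m with
  | zero => exact ⟨0, le_rfl, h0, by omega⟩
  | succ m ih =>
    by_cases h : t ≤ f m
    · obtain ⟨i, hi, h⟩ := ih h fun i hi => hf i (by omega)
      exact ⟨i, by omega, h⟩
    · exact ⟨m, by omega, by omega, hm.trans (hf m (by omega))⟩

/-- Gaps in sets of lengths are bounded by the catenary degree. -/
theorem lengths_gap {c : ℕ} (hc : catenaryDegree H ≤ c) (a : H) {k n t : ℕ}
    (hk : k ∈ lengths a) (hn : n ∈ lengths a) (hkt : k ≤ t) (htn : t ≤ n) :
    ∃ l ∈ lengths a, l ≤ t ∧ t ≤ l + c := by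
  obtain ⟨z, hz, rfl⟩ := mem_lengths_iff.1 hk
  obtain ⟨z', hz', rfl⟩ := mem_lengths_iff.1 hn
  obtain ⟨m, w, rfl, rfl, hw, hd⟩ := catenaryAt_spec a z hz z' hz'
  obtain ⟨i, hi, h⟩ := exists_le_le_add_of_steps (fun i => (w i).card) (c := c) hkt htn
    fun i hi => by
      have h1 : (factDist (w i) (w (i + 1)) : ℕ∞) ≤ c :=
        (hd i hi).trans ((le_iSup (fun a : H => catenaryAt a) a).trans hc)
      have h2 := card_le_card_add_factDist (w i) (w (i + 1))
      have h3 : factDist (w i) (w (i + 1)) ≤ c := by exact_mod_cast h1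
      omega
  exact ⟨_, mem_lengths_iff.2 ⟨w i, hw i hi, rfl⟩, h⟩

theorem distancesOf_finite (hc : catenaryDegree H < ⊤) : (distancesOf H).Finite := by
  obtain ⟨c, hc'⟩ := ENat.ne_top_iff_exists.1 hc.ne
  refine (Set.finite_Iic (c + 1)).subset fun d hd => ?_
  simp only [distancesOf, Set.mem_iUnion] at hd
  obtain ⟨_, ⟨a, rfl⟩, hd0, k, hk, hkd, hno⟩ := hd
  -- With target `k + d - 1`, the length `l` cannot lie strictly inside the gap, so `l ≤ k` and `d ≤
  -- c + 1`.
  obtain ⟨l, hl, hlt, htl⟩ := lengths_gap hc'.ge a hk hkd (t := k + d - 1) (by omega) (by omega)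
  have := hno l hl
  rw [Set.mem_Iic]
  omega

theorem structureTheorem_of_catenaryDegree (hat : IsAtomicMonoid H) (hc : catenaryDegree H < ⊤)
    {K : ℕ} (hK : ∀ k, 1 ≤ k → ∀ n ∈ unionsOfLengths H (k + 1),
      ∃ m ∈ unionsOfLengths H k, n ≤ m + K) :
    StructureTheoremForUnions (unionsOfLengths H) := by
  obtain ⟨c, hc'⟩ := ENat.ne_top_iff_exists.1 hc.ne
  refine (isUnionSystem_unionsOfLengths hat).structureTheorem (δ := c) ?_ hK
  intro k n hn t hkt htn
  by_cases h : ∀ a : H, IsUnit a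
  · rw [unionsOfLengths_of_forall_isUnit h, Set.mem_singleton_iff] at *
    exact ⟨k, rfl, by omega, by omega⟩
  rw [unionsOfLengths_of_exists (not_forall.1 h)] at hn ⊢
  obtain ⟨_, ⟨a, rfl⟩, hk, hn⟩ := hn
  obtain ⟨l, hl, h⟩ := lengths_gap hc'.ge a hk hn hkt htn
  exact ⟨l, ⟨_, ⟨a, rfl⟩, hk, hl⟩, h⟩

theorem rhoAt_succ_le {k K : ℕ} (hK : ∀ n ∈ unionsOfLengths H (k + 1),
      ∃ m ∈ unionsOfLengths H k, n ≤ m + K) : rhoAt H (k + 1) ≤ rhoAt H k + K :=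
  iSup₂_le fun n hn => by
    obtain ⟨m, hm, hnm⟩ := hK n hn
    calc (n : ℕ∞) ≤ ((m + K : ℕ) : ℕ∞) := by exact_mod_cast hnm
      _ = (m : ℕ∞) + K := by push_cast; rfl
      _ ≤ _ := add_le_add_left (le_supSet hm) _

end Factorizations

/-! ### Elasticity -/

theorem div_le_elasticity {L : Set ℕ} {k l : ℕ} (hk : k ∈ L) (hl : l ∈ L) (hk0 : 0 < k) :
    (l : ℝ≥0∞) / k ≤ elasticity L := by
  unfold elasticity
  rw [if_pos ⟨k, hk, hk0⟩]
  rcases Nat.eq_zero_or_pos l with rfl | hl0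
  · simp
  refine ENNReal.div_le_div ?_ ?_
  · have := ENat.toENNReal_mono (le_supSet (L := {n ∈ L | 0 < n}) ⟨hl, hl0⟩)
    simpa using this
  · exact_mod_cast Nat.sInf_le (s := {n ∈ L | 0 < n}) ⟨hk, hk0⟩

theorem elasticity_le {L : Set ℕ} {W : ℕ} (hW : 1 ≤ W)
    (h : ∀ k ∈ L, ∀ l ∈ L, l ≤ W * k) : elasticity L ≤ W := by
  unfold elasticity
  split_ifs with hL
  · have hm := Nat.sInf_mem (s := {n ∈ L | 0 < n}) hL
    refine ENNReal.div_le_of_le_mul ?_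
    have h1 : supSet {n ∈ L | 0 < n} ≤ ((W * sInf {n ∈ L | 0 < n} : ℕ) : ℕ∞) :=
      iSup₂_le fun n hn => by exact_mod_cast h _ hm.1 n hn.1
    have := ENat.toENNReal_mono h1
    simpa using this
  · exact_mod_cast hW

/-- An elasticity that is finite is a quotient of two elements of the set. -/
theorem exists_elasticity_eq {L : Set ℕ} (h : elasticity L < ⊤) (hL : ∃ n ∈ L, 0 < n) :
    ∃ m ∈ L, 0 < m ∧ ∃ n ∈ L, elasticity L = (n : ℝ≥0∞) / m := by
  have hm := Nat.sInf_mem (s := {n ∈ L | 0 < n}) hL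
  unfold elasticity at h ⊢
  rw [if_pos hL] at h ⊢
  have hs : supSet {n ∈ L | 0 < n} ≠ ⊤ := by
    intro hs
    rw [hs, ENat.toENNReal_top, ENNReal.top_div_of_ne_top (ENNReal.natCast_ne_top _)] at h
    exact h.ne rfl
  obtain ⟨n, hn, hsn⟩ := exists_mem_supSet_eq (L := {n ∈ L | 0 < n}) hL hs
  exact ⟨_, hm.1, hm.2, n, hn.1, by rw [hsn, ENat.toENNReal_coe]⟩

section Monoids

variable {H : Type*} [CommMonoid H]

theorem exists_mul_le_of_hasAcceptedElasticity (hat : IsAtomicMonoid H)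
    (hne : ∃ a : H, ¬ IsUnit a) (h : HasAcceptedElasticity H) :
    ∃ m n : ℕ, 0 < m ∧ n ∈ unionsOfLengths H m ∧
      ∀ k, 0 < k → ∀ l ∈ unionsOfLengths H k, l * m ≤ n * k := by
  obtain ⟨L, hL, heq, hlt⟩ := h
  obtain ⟨m, n, hm0, hmn, he⟩ : ∃ m n : ℕ, 0 < m ∧ n ∈ unionsOfLengths H m ∧
      elasticity L = (n : ℝ≥0∞) / m := by
    by_cases hpos : ∃ n ∈ L, 0 < n
    · obtain ⟨m, hm, hm0, n, hn, he⟩ := exists_elasticity_eq hlt hpos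
      refine ⟨m, n, hm0, ?_, he⟩
      rw [unionsOfLengths_of_exists hne]
      exact ⟨L, hL, hm, hn⟩
    -- A set without positive lengths has elasticity `1` by convention, realised by the pair `(1,
    -- 1)`.
    · refine ⟨1, 1, one_pos, (isUnionSystem_unionsOfLengths hat).one, ?_⟩
      unfold elasticity
      rw [if_neg hpos]
      simp
  refine ⟨m, n, hm0, hmn, fun k hk l hl => ?_⟩
  rw [unionsOfLengths_of_exists hne] at hl
  obtain ⟨L', hL', hkL, hlL⟩ := hl
  have h1 : (l : ℝ≥0∞) / k ≤ (n : ℝ≥0∞) / m := by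
    rw [← he, ← heq]
    exact (div_le_elasticity hkL hlL hk).trans
      (le_iSup₂ (f := fun (L : Set ℕ) (_ : L ∈ systemOfLengths H) => elasticity L) L' hL')
  have hm' : (m : ℝ≥0∞) ≠ 0 := by exact_mod_cast hm0.ne'
  have hk' : (k : ℝ≥0∞) ≠ 0 := by exact_mod_cast hk.ne'
  rw [ENNReal.div_le_iff hk' (ENNReal.natCast_ne_top _), ← ENNReal.mul_div_right_comm,
    ENNReal.le_div_iff_mul_le (Or.inl hm') (Or.inl (ENNReal.natCast_ne_top _))] at h1
  exact_mod_cast h1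

theorem exists_bound_of_hasAcceptedElasticity (hat : IsAtomicMonoid H)
    (h : HasAcceptedElasticity H) :
    ∃ K : ℕ, ∀ k, 1 ≤ k → ∀ n ∈ unionsOfLengths H (k + 1),
      ∃ m ∈ unionsOfLengths H k, n ≤ m + K := by
  have hU := isUnionSystem_unionsOfLengths hat
  by_cases hne : ∀ a : H, IsUnit a
  · refine ⟨1, fun k _ n hn => ⟨k, hU.self_mem k, ?_⟩⟩
    rw [unionsOfLengths_of_forall_isUnit hne, Set.mem_singleton_iff] at hn
    omega
  obtain ⟨m, n, hm0, hmn, hb⟩ :=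
    exists_mul_le_of_hasAcceptedElasticity hat (not_forall.1 hne) h
  refine ⟨n, fun k _ l hl => ?_⟩
  -- Writing `k = q * m + r`, the union at `k` contains `q * n + r`, while every length at `k + 1`
  -- is at most `(q + 1) * n`.
  have hmem := hU.add (hU.mul hmn (k / m)) (hU.self_mem (k % m))
  rw [mul_comm (k / m) m, Nat.div_add_mod] at hmem
  refine ⟨_, hmem, ?_⟩
  have h1 := hb (k + 1) (by omega) l hl
  have h2 : k + 1 ≤ m * (k / m + 1) := Nat.lt_mul_div_succ k hm0
  have h3 : l * m ≤ (k / m * n + n) * m :=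
    h1.trans ((Nat.mul_le_mul_left n h2).trans (by rw [← mul_assoc]; apply le_of_eq; ring))
  have h4 := Nat.le_of_mul_le_mul_right h3 hm0
  omega

/-! ### The tame degree -/

theorem tameAt_spec (u : RedAtom H) (a : H) (h : ∃ y ∈ factorizations a, u ∈ y) :
    ∀ z ∈ factorizations a, ∃ z' ∈ factorizations a, u ∈ z' ∧ (factDist z z' : ℕ∞) ≤ tameAt u :=
  csInf_mem (s := {N : ℕ∞ | ∀ a : H, (∃ y ∈ factorizations a, u ∈ y) → ∀ z ∈ factorizations a,
    ∃ z' ∈ factorizations a, u ∈ z' ∧ (factDist z z' : ℕ∞) ≤ N})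
    ⟨⊤, fun _ ⟨y, hy, huy⟩ _ _ => ⟨y, hy, huy, le_top⟩⟩ a h

theorem associates_mul_left_cancel [IsCancelMul H] {a b c : Associates H} (h : a * b = a * c) :
    b = c := by
  obtain ⟨a, rfl⟩ := Associates.mk_surjective a
  obtain ⟨b, rfl⟩ := Associates.mk_surjective b
  obtain ⟨c, rfl⟩ := Associates.mk_surjective c
  simp only [Associates.mk_mul_mk, Associates.mk_eq_mk_iff_associated] at h ⊢
  obtain ⟨w, hw⟩ := h
  exact ⟨w, mul_left_cancel (a := a) (by rw [← mul_assoc, hw])⟩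

/-- One step of size at most `t(H)` brings an atom `u` of the target into `z`. Cancelling `u` leaves
a shorter target, and restoring `u` to that chain does not change distances. -/
theorem reflTransGen_tameDegree [IsCancelMul H] (z' : Factorization H) :
    ∀ z : Factorization H, evalFactorization z = evalFactorization z' →
      Relation.ReflTransGen (fun x y : Factorization H =>
        evalFactorization x = evalFactorization y ∧ (factDist x y : ℕ∞) ≤ tameDegree H) z z' := by
  induction z' using Multiset.induction with
  | empty =>
    intro z hz
    rw [eq_zero_of_isUnit_evalFactorization (z := z) (hz ▸ by simp)]
  | cons u y' ih =>
    intro z hz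
    obtain ⟨a, ha⟩ := Associates.mk_surjective (evalFactorization z)
    obtain ⟨x, hx, hux, hd⟩ := tameAt_spec u a
      ⟨u ::ₘ y', hz.symm.trans ha.symm, Multiset.mem_cons_self u y'⟩ z ha.symm
    obtain ⟨y, rfl⟩ := Multiset.exists_cons_of_mem hux
    have hx' : evalFactorization z = evalFactorization (u ::ₘ y) := ha.symm.trans (Eq.symm hx)
    have hy : evalFactorization y = evalFactorization y' := by
      rw [hx', evalFactorization_cons, evalFactorization_cons] at hz
      exact associates_mul_left_cancel hz
    refine Relation.ReflTransGen.head
      ⟨hx', hd.trans (le_iSup (fun u : RedAtom H => tameAt u) u)⟩ ?_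
    refine (ih y hy).lift (u ::ₘ ·) fun b c hbc => ⟨?_, ?_⟩
    · simp only [evalFactorization_cons, hbc.1]
    · simpa only [factDist_cons] using hbc.2

theorem catenaryDegree_le_tameDegree [IsCancelMul H] : catenaryDegree H ≤ tameDegree H := by
  refine iSup_le fun a => sInf_le fun z hz z' hz' => ?_
  have h := reflTransGen_tameDegree z' z (Eq.trans hz (Eq.symm hz'))
  clear hz
  induction h using Relation.ReflTransGen.head_induction_on with
  | refl => exact ⟨0, fun _ => z', rfl, rfl, fun _ _ => hz', by simp⟩
  | @head x y hxy hyz ih =>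
    obtain ⟨k, w, hw0, hwk, hw, hd⟩ := ih
    refine ⟨k + 1, fun i => Nat.casesOn i x w, rfl, hwk, ?_, ?_⟩
    · rintro (_ | i) hi
      · exact hxy.1.trans (hw0 ▸ hw 0 (Nat.zero_le _))
      · exact hw i (by omega)
    · rintro (_ | i) hi
      · change (factDist x (w 0) : ℕ∞) ≤ _
        rw [hw0]
        exact hxy.2
      · exact hd i (by omega)

/-! ### Consequences of the finiteness of the `ω`-invariant -/

/-- The multiset is indexed by an arbitrary type, so the subproduct is remembered as a submultiset
of atom classes and not only of their representatives in `H`. -/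
theorem omegaAt_spec {W : ℕ} (hW : omega H ≤ W) {u : H} (hu : Irreducible u)
    {ι : Type*} (f : ι → H) (s : Multiset ι) (h : u ∣ (s.map f).prod) :
    ∃ t ≤ s, t.card ≤ W ∧ u ∣ (t.map f).prod := by
  obtain ⟨l, rfl⟩ := Quot.exists_rep s
  have hmem := csInf_mem (s := {N : ℕ∞ | ∀ n : ℕ, 0 < n → ∀ a : Fin n → H,
    ∏ i, a i ∈ {b : H | u ∣ b} →
      ∃ Ω : Finset (Fin n), (Ω.card : ℕ∞) ≤ N ∧ ∏ i ∈ Ω, a i ∈ {b : H | u ∣ b}})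
    ⟨⊤, fun n _ a ha => ⟨Finset.univ, le_top, ha⟩⟩
  have hle : omegaAt u ≤ W :=
    (le_iSup₂ (f := fun (u : H) (_ : Irreducible u) => omegaAt u) u hu).trans hW
  rcases Nat.eq_zero_or_pos l.length with h0 | h0
  · obtain rfl := List.length_eq_zero_iff.1 h0
    exact (hu.not_isUnit (isUnit_of_dvd_one (by simpa using h))).elim
  have huniv : (Finset.univ.val.map l.get : Multiset ι) = (l : Multiset ι) := by
    simp [Fin.univ_val_map]
  obtain ⟨Ω, hΩ, hd⟩ := hmem l.length h0 (f ∘ l.get) (by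
    rw [Set.mem_ofPred_eq, Finset.prod, ← Multiset.map_map, huniv]
    exact h)
  refine ⟨Ω.val.map l.get, ?_, ?_, by rwa [Multiset.map_map]⟩
  · exact (Multiset.map_le_map (Finset.val_le_iff.2 Ω.subset_univ)).trans huniv.le
  · rw [Multiset.card_map]
    exact_mod_cast hΩ.trans hle

/-- The exchange step: `t` is the part of `z` to be replaced by `u ::ₘ y`. -/
theorem exists_le_of_dvd_evalFactorization (hat : IsAtomicMonoid H) {W : ℕ} (hW : omega H ≤ W)
    (u : RedAtom H) (z : Factorization H) (h : u.1 ∣ evalFactorization z) :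
    ∃ t y : Factorization H, t ≤ z ∧ t.card ≤ W ∧
      evalFactorization t = evalFactorization (u ::ₘ y) := by
  obtain ⟨v, hv⟩ := Associates.mk_surjective u.1
  have hout : ∀ t : Factorization H,
      Associates.mk (t.map fun x => Quot.out x.1).prod = evalFactorization t := fun t => by
    rw [← Associates.prod_mk, Multiset.map_map, evalFactorization]
    simp [Associates.quot_out]
  rw [← hv, ← hout, Associates.mk_dvd_mk] at h
  obtain ⟨t, ht, hc, hd⟩ := omegaAt_spec hW (irreducible_associatesMk.1 (hv ▸ u.2)) _ z h
  rw [← Associates.mk_dvd_mk, hv, hout] at hd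
  obtain ⟨b, hb⟩ := hd
  obtain ⟨y, rfl⟩ := exists_factorization hat b
  exact ⟨t, y, ht, hc, by rw [hb, evalFactorization_cons]⟩

/-- Each atom `u` removed from `x` costs at most `W` atoms of `z`: replace `t` by `u ::ₘ y` and
cancel `u`; induction then bounds `y + r`. -/
theorem card_le_omega_mul_card [IsCancelMul H] (hat : IsAtomicMonoid H) {W : ℕ}
    (hW : omega H ≤ W) (x : Factorization H) :
    ∀ z : Factorization H, evalFactorization x = evalFactorization z → z.card ≤ W * x.card := by
  induction x using Multiset.induction with
  | empty =>
    intro z hz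
    rw [eq_zero_of_isUnit_evalFactorization (z := z) (hz ▸ by simp)]
    simp
  | cons u x ih =>
    intro z hz
    obtain ⟨t, y, ht, hc, he⟩ := exists_le_of_dvd_evalFactorization hat hW u z
      ⟨_, by rw [← hz, evalFactorization_cons]⟩
    obtain ⟨r, rfl⟩ := Multiset.le_iff_exists_add.1 ht
    have := ih (y + r) (associates_mul_left_cancel (a := u.1) (by
      rw [← evalFactorization_cons, hz, evalFactorization_add, he, evalFactorization_cons,
        evalFactorization_add, mul_assoc]))
    simp only [Multiset.card_add, Multiset.card_cons, mul_add] at this ⊢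
    omega

theorem tameDegree_le_omega_sq [IsCancelMul H] (hat : IsAtomicMonoid H) {W : ℕ}
    (hW : omega H ≤ W) : tameDegree H ≤ ((W ^ 2 : ℕ) : ℕ∞) := by
  refine iSup_le fun u => sInf_le ?_
  rintro a ⟨x, hx, hux⟩ z hz
  obtain ⟨x, rfl⟩ := Multiset.exists_cons_of_mem hux
  obtain ⟨t, y, ht, hc, he⟩ := exists_le_of_dvd_evalFactorization hat hW u z
    ⟨_, (Eq.trans hz (Eq.symm hx)).trans (evalFactorization_cons u x)⟩
  obtain ⟨r, rfl⟩ := Multiset.le_iff_exists_add.1 ht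
  refine ⟨(u ::ₘ y) + r, ?_, by simp, ?_⟩
  -- Only `t` is exchanged, so the distance is at most the larger of `|t| ≤ W` and `|u ::ₘ y| ≤ W *
  -- |t| ≤ W ^ 2`.
  · refine Eq.trans ?_ hz
    rw [evalFactorization_add, evalFactorization_add, he]
  · have h1 := card_le_omega_mul_card hat hW t _ he
    have h2 : W * t.card ≤ W ^ 2 := by rw [sq]; exact Nat.mul_le_mul_left W hc
    have h3 := factDist_le_max t (u ::ₘ y)
    have h4 : t.card ≤ W ^ 2 := hc.trans (Nat.le_self_pow two_ne_zero W)
    rw [factDist_add_right]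
    exact_mod_cast h3.trans (max_le h4 (h1.trans h2))

theorem one_le_of_omega_le [IsCancelMul H] (hat : IsAtomicMonoid H) {W : ℕ} (hW : omega H ≤ W)
    (u : RedAtom H) : 1 ≤ W := by
  have := card_le_omega_mul_card hat hW {u} {u} rfl
  simpa using this

theorem elasticityOf_le_omega [IsCancelMul H] (hat : IsAtomicMonoid H) {W : ℕ}
    (hW : omega H ≤ W) (hne : ∃ a : H, ¬ IsUnit a) : elasticityOf H ≤ W := by
  obtain ⟨u⟩ := exists_redAtom hat hne
  refine iSup₂_le ?_
  rintro _ ⟨a, rfl⟩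
  refine elasticity_le (one_le_of_omega_le hat hW u) fun k hk l hl => ?_
  obtain ⟨z, hz, rfl⟩ := mem_lengths_iff.1 hk
  obtain ⟨z', hz', rfl⟩ := mem_lengths_iff.1 hl
  exact card_le_omega_mul_card hat hW z z' (Eq.trans hz (Eq.symm hz'))

theorem exists_mem_unionsOfLengths_of_omega [IsCancelMul H] (hat : IsAtomicMonoid H) {W : ℕ}
    (hW : omega H ≤ W) (k : ℕ) : ∀ n ∈ unionsOfLengths H (k + 1),
      ∃ m ∈ unionsOfLengths H k, n ≤ m + max 1 (W - 1) := by
  intro n hn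
  by_cases hne : ∀ a : H, IsUnit a
  · rw [unionsOfLengths_of_forall_isUnit hne, Set.mem_singleton_iff] at hn
    refine ⟨k, (isUnionSystem_unionsOfLengths hat).self_mem k, ?_⟩
    have := le_max_left 1 (W - 1)
    omega
  rw [not_forall] at hne
  obtain ⟨x, z, hxz, hx, rfl⟩ := (mem_unionsOfLengths_iff hne).1 hn
  obtain ⟨u, x, rfl⟩ : ∃ u x', x = u ::ₘ x' := by
    obtain ⟨u, hu⟩ := Multiset.card_pos_iff_exists_mem.1 (show 0 < x.card by omega)
    exact ⟨u, Multiset.exists_cons_of_mem hu⟩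
  obtain ⟨t, y, ht, hc, he⟩ := exists_le_of_dvd_evalFactorization hat hW u z
    ⟨_, by rw [← hxz, evalFactorization_cons]⟩
  obtain ⟨r, rfl⟩ := Multiset.le_iff_exists_add.1 ht
  have heq : evalFactorization x = evalFactorization (y + r) :=
    associates_mul_left_cancel (a := u.1) (by
      rw [← evalFactorization_cons, hxz, evalFactorization_add, he, evalFactorization_cons,
        evalFactorization_add, mul_assoc])
  refine ⟨(y + r).card, (mem_unionsOfLengths_iff hne).2 ⟨x, _, heq, by simpa using hx, rfl⟩, ?_⟩
  have h1 := le_max_left 1 (W - 1)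
  have h2 := le_max_right 1 (W - 1)
  rw [Multiset.card_add, Multiset.card_add]
  -- The loss is `|t| - |y|`. If `y` is empty, `t` evaluates to the atom `u` and has length one;
  -- otherwise the loss is at most `W - 1`. Hence the maximum with `1`.
  rcases Nat.eq_zero_or_pos y.card with hy | hy
  · rw [Multiset.card_eq_zero.1 hy] at he
    have := card_eq_one_of_evalFactorization_eq (u := u) (he.trans (by rw [evalFactorization_cons, evalFactorization_zero, mul_one]))
    omega
  · omega

end Monoids

end LengthSets

theorem mainTheorem4 {H : Type*} [CommMonoid H]
    (hH : LengthSets.IsUnitCancellative H) (hat : LengthSets.IsAtomicMonoid H) :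
    (LengthSets.catenaryDegree H < ⊤ → LengthSets.HasAcceptedElasticity H →
      (LengthSets.distancesOf H).Finite ∧
      (∃ K : ℕ, ∀ k : ℕ, 1 ≤ k →
        LengthSets.rhoAt H (k + 1) ≤ LengthSets.rhoAt H k + (K : ℕ∞)) ∧
      LengthSets.StructureTheoremForUnions (LengthSets.unionsOfLengths H)) ∧
    (IsCancelMul H → LengthSets.omega H < ⊤ →
      LengthSets.catenaryDegree H ≤ LengthSets.tameDegree H ∧
      LengthSets.tameDegree H ≤ LengthSets.omega H ^ 2 ∧
      ((∃ a : H, ¬ IsUnit a) →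
        LengthSets.elasticityOf H ≤ ((LengthSets.omega H : ℕ∞) : ℝ≥0∞)) ∧
      (∀ k : ℕ, 1 ≤ k →
        LengthSets.rhoAt H (k + 1) ≤
          LengthSets.rhoAt H k + max 1 (LengthSets.omega H - 1)) ∧
      LengthSets.StructureTheoremForUnions (LengthSets.unionsOfLengths H)) := by
  refine ⟨fun hc hacc => ?_, fun hcancel hω => ?_⟩
  · obtain ⟨K, hK⟩ := LengthSets.exists_bound_of_hasAcceptedElasticity hat hacc
    exact ⟨LengthSets.distancesOf_finite hc,
      ⟨K, fun k hk => LengthSets.rhoAt_succ_le (hK k hk)⟩,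
      LengthSets.structureTheorem_of_catenaryDegree hat hc hK⟩
  · obtain ⟨W, hW⟩ := ENat.ne_top_iff_exists.1 hω.ne
    have hct := LengthSets.catenaryDegree_le_tameDegree (H := H)
    have hts := LengthSets.tameDegree_le_omega_sq hat hW.ge
    have hK := LengthSets.exists_mem_unionsOfLengths_of_omega hat hW.ge
    refine ⟨hct, ?_, fun hne => ?_, fun k _ => ?_,
      LengthSets.structureTheorem_of_catenaryDegree hat
        ((hct.trans hts).trans_lt (ENat.natCast_lt_top _)) fun k _ => hK k⟩
    · rw [← hW]
      exact_mod_cast hts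
    · rw [← hW, ENat.toENNReal_coe]
      exact LengthSets.elasticityOf_le_omega hat hW.ge hne
    · rw [← hW]
      exact_mod_cast LengthSets.rhoAt_succ_le (hK k)
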